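/- Let $\mathbb{MON}$ be the lattice of all varieties of monoids, ordered by inclusion, where a variety of monoids is the class $\operatorname{var}\Sigma$ of all monoids satisfying some system $\Sigma$ of identities $\mathbf u\approx\mathbf v$ between words of the free monoid over a countably infinite alphabet (monoids being considered with the identity element as a 0-ary operation). An element $x$ of a lattice $L$ is called *modular* if $(x\vee y)\wedge z=(x\wedge z)\vee y$ for all $y,z\in L$ with $y\le z$, and *costandard* if $(x\wedge y)\vee z=(x\vee z)\wedge(y\vee z)$ for all $y,z\in L$. Put $\mathbf D=\operatorname{var}\{x^2\approx x^3,\ x^2y\approx xyx\approx yx^2\}$. Then $\mathbf D$ is a modular element of $\mathbb{MON}$, and $\mathbf D$ is not a costandard element of $\mathbb{MON}$. Consequently, the properties of being a modular element and of being a costandard element are not equivalent in $\mathbb{MON}$. -/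

import Mathlib

universe u

/-- An element `x` of a lattice is *modular* if
`y ≤ z` implies `(x ∨ y) ∧ z = (x ∧ z) ∨ y`, for all `y` and `z`. -/
def IsModularElement {L : Type*} [Lattice L] (x : L) : Prop :=
  ∀ y z : L, y ≤ z → (x ⊔ y) ⊓ z = (x ⊓ z) ⊔ y

/-- An element `x` of a lattice is *costandard* if it satisfies the dual of
`(x ∨ y) ∧ z = (x ∧ z) ∨ (y ∧ z)` (the condition for a standard element), for all `y` and `z`. -/
def IsCostandardElement {L : Type*} [Lattice L] (x : L) : Prop :=
  ∀ y z : L, (x ⊓ y) ⊔ z = (x ⊔ z) ⊓ (y ⊔ z)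

/-- A monoid identity `p.1 ≈ p.2`: a pair of words, possibly empty, over the countably infinite
alphabet `ℕ`. -/
abbrev MonoidIdentity : Type := FreeMonoid ℕ × FreeMonoid ℕ

/-- The monoid `M` satisfies the identity `p`: both sides get the same value under every
assignment of elements of `M` to the letters. -/
def MonoidIdentity.HoldsIn (p : MonoidIdentity) (M : Type u) [Monoid M] : Prop :=
  ∀ f : ℕ → M, FreeMonoid.lift f p.1 = FreeMonoid.lift f p.2

/-- The class of all monoids that satisfy every identity of the system `S`. -/
def monoidModels (S : Set MonoidIdentity) : Set MonCat.{u} :=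
  {M | ∀ p ∈ S, p.HoldsIn M}

/-- The set of all identities that hold in every monoid of the class `K`. -/
def monoidIdentities (K : Set MonCat.{u}) : Set MonoidIdentity :=
  {p | ∀ M ∈ K, p.HoldsIn M}

/-- A variety of monoids: a class of monoids given by some system of identities. -/
@[ext]
structure MonoidVariety : Type (u + 1) where
  carrier : Set MonCat.{u}
  isEquational : ∃ S : Set MonoidIdentity, carrier = monoidModels S

namespace MonoidVariety

/-- `var S`: the variety given by the identity system `S`. -/
def var (S : Set MonoidIdentity) : MonoidVariety.{u} :=
  ⟨monoidModels S, S, rfl⟩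

/-- Varieties are ordered by inclusion of classes. -/
instance : PartialOrder MonoidVariety.{u} :=
  PartialOrder.lift carrier fun _ _ h => MonoidVariety.ext h

/-- The lattice of all monoid varieties under inclusion. The meet is the intersection;
the join is the class given by all identities that are common to the two varieties, and the fields
below show that it is the least variety containing both. -/
instance : Lattice MonoidVariety.{u} where
  sup V W := var (monoidIdentities (V.carrier ∪ W.carrier))
  le_sup_left _ _ := fun M hM _ hp => hp M (Or.inl hM)
  le_sup_right _ _ := fun M hM _ hp => hp M (Or.inr hM)
  sup_le V W X hV hW := by
    obtain ⟨S, hS⟩ := X.isEquational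
    intro M hM
    rw [hS]
    intro p hp
    refine hM p fun N hN => ?_
    have hX : N ∈ X.carrier := hN.elim (fun h => hV h) (fun h => hW h)
    rw [hS] at hX
    exact hX p hp
  inf V W := ⟨V.carrier ∩ W.carrier, by
    obtain ⟨S, hS⟩ := V.isEquational
    obtain ⟨T, hT⟩ := W.isEquational
    refine ⟨S ∪ T, ?_⟩
    rw [hS, hT]
    ext M
    exact ⟨fun h p hp => hp.elim (h.1 p) (h.2 p),
      fun h => ⟨fun p hp => h p (Or.inl hp), fun p hp => h p (Or.inr hp)⟩⟩⟩
  inf_le_left _ _ := fun _ hM => hM.1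
  inf_le_right _ _ := fun _ hM => hM.2
  le_inf _ _ _ hV hW := fun _ hM => ⟨hV hM, hW hM⟩

/-- The letter `x`. -/
def letterX : FreeMonoid ℕ := FreeMonoid.of 0

/-- The letter `y`. -/
def letterY : FreeMonoid ℕ := FreeMonoid.of 1

/-- The variety `D = var {x² ≈ x³, x²y ≈ xyx ≈ yx²}`. -/
def varietyD : MonoidVariety.{u} :=
  var {(letterX ^ 2, letterX ^ 3),
    (letterX ^ 2 * letterY, letterX * letterY * letterX),
    (letterX * letterY * letterX, letterY * letterX ^ 2)}

end MonoidVariety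

/-! ### Evaluation of words -/

section Words

open scoped List

variable {M : Type*} [Monoid M]

/-! In `D` squares are central and absorb further copies of their letter, so a word is determined by
its repeated letters and by `simplePart`, the order of its simple letters
(`holdsIn_of_simplePart_eq`). Modularity: only `(D ∨ Y) ∧ Z ≤ (D ∧ Z) ∨ Y` needs work. If every
identity of `Z` holds in `D`, then `D ≤ Z`. Otherwise a failing identity makes `Z` satisfy `x ^ j =
1`, or `x ^ j = x` with `j ≥ 2`, or `xy = yx`. In each case an identity of the right side is
rewritten, modulo `Z`, into one that holds in both `D` and `Y`. Not costandard: left regular bands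
meet `D` in a commutative variety, yet their join with the commutative variety `commAperiodic`
contains `D`. The law would make `D` commutative, which `Nilpotent5` refutes. -/

theorem MonoidIdentity.holdsIn_iff {p : MonoidIdentity} :
    p.HoldsIn M ↔ ∀ f : ℕ → M, (p.1.toList.map f).prod = (p.2.toList.map f).prod := by
  simp only [MonoidIdentity.HoldsIn, FreeMonoid.lift_apply]

theorem prod_map_mulSingle (a : ℕ) (x : M) (w : List ℕ) :
    (w.map (Pi.mulSingle a x : ℕ → M)).prod = x ^ w.count a := by
  induction w with
  | nil => simp
  | cons c w ih =>
    by_cases h : c = a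
    · subst h
      simp [ih, pow_succ']
    · simp [ih, h, List.count_cons_of_ne h]

theorem MonoidIdentity.HoldsIn.pow_count_eq {p : MonoidIdentity} (h : p.HoldsIn M) (a : ℕ)
    (x : M) : x ^ p.1.toList.count a = x ^ p.2.toList.count a := by
  simpa only [prod_map_mulSingle] using
    MonoidIdentity.holdsIn_iff.1 h (Pi.mulSingle a x)

/-- The subword of `w` formed by the letters that occur in `w` exactly once. -/
def simplePart (w : List ℕ) : List ℕ := w.filter fun a => w.count a = 1

theorem mem_simplePart {w : List ℕ} {a : ℕ} : a ∈ simplePart w ↔ w.count a = 1 := by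
  simp only [simplePart, List.mem_filter, decide_eq_true_eq, and_iff_right_iff_imp]
  intro h
  exact List.count_pos_iff.1 (by omega)

theorem nodup_simplePart (w : List ℕ) : (simplePart w).Nodup := by
  rw [List.nodup_iff_count_le_one]
  intro a
  by_cases h : w.count a = 1
  · exact (List.Sublist.count_le a List.filter_sublist).trans h.le
  · rw [List.count_eq_zero.2 (fun h' => h (mem_simplePart.1 h'))]
    omega

/-- The words `u` and `v` have the same letters and the same letters that occur exactly once. -/
def SameOccurrence (u v : List ℕ) : Prop := ∀ a, min (u.count a) 2 = min (v.count a) 2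

theorem SameOccurrence.count_eq_one_iff {u v : List ℕ} (h : SameOccurrence u v) (a : ℕ) :
    u.count a = 1 ↔ v.count a = 1 := by
  have := h a
  omega

/-- Erasing every letter but `a` and `b` leaves exactly the word `ab`, as both are simple in `w`. -/
theorem prod_map_pair {w : List ℕ} {a b : ℕ} (h : [a, b] <+ simplePart w) (x y : M) :
    (w.map fun c => if c = a then x else if c = b then y else 1).prod = x * y := by
  have hab : a ≠ b := by simpa using (nodup_simplePart w).sublist h
  have ha : w.count a = 1 := mem_simplePart.1 (h.subset (by simp))
  have hb : w.count b = 1 := mem_simplePart.1 (h.subset (by simp))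
  have key : [a, b] = w.filter fun c => c = a ∨ c = b := by
    refine List.Sublist.eq_of_length ?_ ?_
    · have := (h.trans List.filter_sublist).filter fun c => decide (c = a ∨ c = b)
      simpa using this
    · have : ∀ l : List ℕ,
          (l.filter fun c => c = a ∨ c = b).length = l.count a + l.count b := by
        intro l
        induction l with
        | nil => rfl
        | cons c l ih =>
          simp only [List.filter_cons, List.count_cons, beq_iff_eq, decide_eq_true_eq]
          split_ifs <;> simp_all <;> omega
      rw [this, ha, hb]
      rfl
  have hprod : ∀ (l : List ℕ),
      (l.map fun c => if c = a then x else if c = b then y else 1).prod =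
      ((l.filter fun c => c = a ∨ c = b).map
        fun c => if c = a then x else if c = b then y else 1).prod := by
    intro l
    induction l with
    | nil => rfl
    | cons c l ih =>
      by_cases hc : c = a ∨ c = b
      · simp [hc, ih]
      · have := not_or.1 hc
        simp [ih, this.1, this.2]
  rw [hprod, ← key]
  simp [hab.symm]

/-- If the simple letters of `u` and `v` come in different orders, then two of them are swapped. -/
theorem exists_swapped_pair {u v : List ℕ} (h : SameOccurrence u v) (hne : simplePart u ≠ simplePart v) :
    ∃ a b, [b, a] <+ simplePart u ∧ [a, b] <+ simplePart v := by
  by_contra! hno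
  have hmem : ∀ a, a ∈ simplePart u ↔ a ∈ simplePart v := fun a => by
    rw [mem_simplePart, mem_simplePart, h.count_eq_one_iff]
  have total : ∀ {l : List ℕ} {a b : ℕ}, a ∈ l → b ∈ l → a ≠ b → [a, b] <+ l ∨ [b, a] <+ l := by
    intro l a b
    induction l with
    | nil => simp
    | cons c l ih =>
      intro ha hb hab
      rcases List.mem_cons.1 ha with rfl | ha'
      · exact Or.inl (List.Sublist.cons_cons _
          (List.singleton_sublist.2 ((List.mem_cons.1 hb).resolve_left hab.symm)))
      rcases List.mem_cons.1 hb with rfl | hb'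
      · exact Or.inr (List.Sublist.cons_cons _ (List.singleton_sublist.2 ha'))
      exact (ih ha' hb' hab).imp (fun h => h.cons _) (fun h => h.cons _)
  have perm : (simplePart u).Perm (simplePart v) :=
    (List.perm_ext_iff_of_nodup (nodup_simplePart u) (nodup_simplePart v)).2 hmem
  -- Precedence in `simplePart u` is antisymmetric, and without a swapped pair both lists are sorted
  -- for it; sorted permutations coincide.
  refine hne (perm.eq_of_pairwise (le := fun a b => [a, b] <+ simplePart u) ?_ ?_ ?_)
  · intro a b _ _ h1 h2
    by_contra hab
    have := nodup_simplePart u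
    have hu : ∀ l : List ℕ, l.Nodup → [a, b] <+ l → ¬ [b, a] <+ l := by
      intro l
      induction l with
      | nil => simp
      | cons c l ih =>
        intro hl h3 h4
        obtain ⟨hc, hl⟩ := List.nodup_cons.1 hl
        cases h3 with
        | cons _ h3 =>
          cases h4 with
          | cons _ h4 => exact ih hl h3 h4
          | cons_cons _ h4 => exact hc (h3.subset (by simp))
        | cons_cons _ h3 =>
          cases h4 with
          | cons _ h4 => exact hc (h4.subset (by simp))
          | cons_cons _ h4 => exact hab rfl
    exact hu _ this h1 h2
  · exact List.pairwise_iff_forall_sublist.2 fun h => h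
  · refine List.pairwise_iff_forall_sublist.2 fun {a b} hs => ?_
    have hab : a ≠ b := by simpa using (nodup_simplePart v).sublist hs
    exact (total ((hmem a).2 (hs.subset (by simp))) ((hmem b).2 (hs.subset (by simp))) hab).elim
      id fun h' => absurd hs (hno a b h')

/-- An identity that only changes the order of simple letters yields a commutation. -/
theorem MonoidIdentity.HoldsIn.exists_mul_eq {p : MonoidIdentity}
    (h : SameOccurrence p.1.toList p.2.toList)
    (hne : simplePart p.1.toList ≠ simplePart p.2.toList) (hM : p.HoldsIn M) (x y : M) :
    x * y = y * x := by
  obtain ⟨a, b, h1, h2⟩ := exists_swapped_pair h hne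
  have hab : a ≠ b := by simpa using (nodup_simplePart _).sublist h2
  have e := MonoidIdentity.holdsIn_iff.1 hM
    (fun c => if c = b then x else if c = a then y else 1)
  rw [prod_map_pair h1] at e
  rw [e, ← prod_map_pair h2 y x]
  congr 1
  refine List.map_congr_left fun c _ => ?_
  by_cases hc : c = a
  · subst hc
    simp [hab]
  · simp [hc]

theorem pow_eq_pow_of_min_eq {x : M} (hx : x ^ 2 = x ^ 3) {i j : ℕ} (h : min i 2 = min j 2) :
    x ^ i = x ^ j := by
  have hk : ∀ k, x ^ (k + 2) = x ^ 2 := by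
    intro k
    induction k with
    | zero => rfl
    | succ k ih => rw [show k + 1 + 2 = (k + 2) + 1 by ring, pow_succ, ih, ← pow_succ, ← hx]
  by_cases hi : i < 2
  · rw [show i = j by omega]
  · obtain ⟨i, rfl⟩ := Nat.exists_eq_add_of_le' (not_lt.1 hi)
    obtain ⟨j, rfl⟩ := Nat.exists_eq_add_of_le' (show 2 ≤ j by omega)
    rw [hk i, hk j]

end Words

/-! ### Identities in commutative monoids -/

section CommutativeModels

variable {M : Type*} [CommMonoid M]

theorem MonoidIdentity.holdsIn_of_sameOccurrence {p : MonoidIdentity}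
    (h : SameOccurrence p.1.toList p.2.toList) (hM : ∀ x : M, x ^ 2 = x ^ 3) : p.HoldsIn M := by
  rw [MonoidIdentity.holdsIn_iff]
  intro f
  have hs : p.1.toList.toFinset = p.2.toList.toFinset := by
    ext a
    have := h a
    rw [List.mem_toFinset, List.mem_toFinset, ← List.count_pos_iff, ← List.count_pos_iff]
    omega
  rw [Finset.prod_list_map_count, Finset.prod_list_map_count, hs]
  exact Finset.prod_congr rfl fun a _ => pow_eq_pow_of_min_eq (hM _) (h a)

theorem MonoidIdentity.holdsIn_of_same_content {p : MonoidIdentity}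
    (h : ∀ a, p.1.toList.count a = 0 ↔ p.2.toList.count a = 0) (hM : ∀ x : M, x ^ 2 = x) :
    p.HoldsIn M := by
  rw [MonoidIdentity.holdsIn_iff]
  intro f
  have hs : p.1.toList.toFinset = p.2.toList.toFinset := by
    ext a
    have := h a
    rw [List.mem_toFinset, List.mem_toFinset, ← List.count_pos_iff, ← List.count_pos_iff]
    omega
  have hpow : ∀ (x : M) (k : ℕ), k ≠ 0 → x ^ k = x := fun x k hk =>
    IsIdempotentElem.pow_eq (show x * x = x by rw [← sq, hM]) hk
  rw [Finset.prod_list_map_count, Finset.prod_list_map_count, hs]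
  refine Finset.prod_congr rfl fun a ha => ?_
  have h2 : p.2.toList.count a ≠ 0 := by
    have := List.count_pos_iff.2 (List.mem_toFinset.1 ha)
    omega
  rw [hpow _ _ h2, hpow _ _ (mt (h a).1 h2)]

end CommutativeModels

namespace MonoidVariety

/-! ### Identities of the variety `D` -/

theorem mem_varietyD_iff {M : MonCat.{u}} :
    M ∈ varietyD.{u}.carrier ↔
      ∀ x y : M, x ^ 2 = x ^ 3 ∧ x ^ 2 * y = x * y * x ∧ x * y * x = y * x ^ 2 := by
  constructor
  · intro h x y
    have h1 := h _ (Or.inl rfl) (fun n => if n = 0 then x else y)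
    have h2 := h _ (Or.inr (Or.inl rfl)) (fun n => if n = 0 then x else y)
    have h3 := h _ (Or.inr (Or.inr rfl)) (fun n => if n = 0 then x else y)
    simp only [map_mul, map_pow, letterX, letterY, FreeMonoid.lift_eval_of, if_true,
      one_ne_zero, if_false] at h1 h2 h3
    exact ⟨h1, h2, h3⟩
  · rintro h p (rfl | rfl | rfl) f
    · simpa [letterX, letterY] using (h (f 0) (f 1)).1
    · simpa [letterX, letterY] using (h (f 0) (f 1)).2.1
    · simpa [letterX, letterY] using (h (f 0) (f 1)).2.2

section

variable {M : Type*} [Monoid M]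

/-- The central element `x ^ 2` travels along the word and swallows each `x` it meets. -/
theorem sq_mul_prod_filter {x : M} (f : ℕ → M) (a : ℕ) (hx : f a = x) (h1 : x ^ 2 = x ^ 3)
    (h2 : ∀ y, x ^ 2 * y = y * x ^ 2) (w : List ℕ) :
    x ^ 2 * (w.map f).prod = x ^ 2 * ((w.filter (· ≠ a)).map f).prod := by
  induction w with
  | nil => rfl
  | cons c w ih =>
    by_cases hc : c = a
    · subst hc
      rw [List.filter_cons_of_neg (by simp), ← ih, List.map_cons, List.prod_cons, hx, ← mul_assoc,
        ← pow_succ, ← h1]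
    · simp only [List.map_cons, List.prod_cons, ne_eq, hc, not_false_eq_true, decide_true,
        List.filter_cons_of_pos]
      rw [← mul_assoc, h2, mul_assoc, ih, ← mul_assoc, ← h2, mul_assoc]

theorem prod_eq_sq_mul_prod_filter
    (hM : ∀ x y : M, x ^ 2 = x ^ 3 ∧ x ^ 2 * y = x * y * x ∧ x * y * x = y * x ^ 2)
    (f : ℕ → M) {a : ℕ} {w : List ℕ} (hw : 2 ≤ w.count a) :
    (w.map f).prod = f a ^ 2 * ((w.filter (· ≠ a)).map f).prod := by
  have central : ∀ y, f a ^ 2 * y = y * f a ^ 2 := fun y =>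
    (hM (f a) y).2.1.trans (hM (f a) y).2.2
  -- With the erased copies of `a` restored, it remains to see that a factor `f a ^ 2` changes
  -- nothing: two occurrences of `a` already produce that square.
  rw [← sq_mul_prod_filter f a rfl (hM _ 1).1 central]
  obtain ⟨s, t, rfl, hs⟩ := List.eq_append_cons_of_mem
    (List.count_pos_iff.1 (by omega : 0 < w.count a))
  have ht : a ∈ t := by
    rw [List.count_append, List.count_eq_zero.2 hs, List.count_cons_self] at hw
    exact List.count_pos_iff.1 (by omega)
  obtain ⟨t, r, rfl⟩ := List.append_of_mem ht
  simp only [List.map_append, List.map_cons, List.prod_append, List.prod_cons]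
  generalize (s.map f).prod = s
  generalize (t.map f).prod = t
  generalize (r.map f).prod = r
  have e : f a * (t * (f a * r)) = f a ^ 2 * (t * r) := by
    rw [← mul_assoc, ← mul_assoc, ← (hM (f a) t).2.1, mul_assoc]
  rw [e, ← mul_assoc s, ← central, mul_assoc (f a ^ 2), ← mul_assoc (f a ^ 2) (f a ^ 2),
    ← pow_add, pow_eq_pow_of_min_eq (hM (f a) 1).1 (show min (2 + 2) 2 = min 2 2 by rfl)]

theorem prod_eq_prod_sq_mul_prod_filter
    (hM : ∀ x y : M, x ^ 2 = x ^ 3 ∧ x ^ 2 * y = x * y * x ∧ x * y * x = y * x ^ 2)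
    (f : ℕ → M) (A : List ℕ) (hA : A.Nodup) (w : List ℕ) (hw : ∀ a ∈ A, 2 ≤ w.count a) :
    (w.map f).prod = (A.map (f · ^ 2)).prod * ((w.filter (· ∉ A)).map f).prod := by
  induction A generalizing w with
  | nil => simp
  | cons a A ih =>
    obtain ⟨ha, hA⟩ := List.nodup_cons.1 hA
    rw [prod_eq_sq_mul_prod_filter hM f (hw a (by simp)), ih hA (w.filter (· ≠ a)),
      List.filter_filter, List.map_cons, List.prod_cons, mul_assoc]
    · congr 4
      refine List.filter_congr fun c _ => ?_
      simp [not_or, Bool.and_comm]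
    · intro b hb
      rw [List.count_filter]
      · exact hw b (by simp [hb])
      · simpa using fun h : b = a => ha (h ▸ hb)

theorem holdsIn_of_simplePart_eq
    (hM : ∀ x y : M, x ^ 2 = x ^ 3 ∧ x ^ 2 * y = x * y * x ∧ x * y * x = y * x ^ 2)
    {p : MonoidIdentity} (h : SameOccurrence p.1.toList p.2.toList)
    (hs : simplePart p.1.toList = simplePart p.2.toList) : p.HoldsIn M := by
  rw [MonoidIdentity.holdsIn_iff]
  intro f
  set u := p.1.toList
  set v := p.2.toList
  set A := (u.filter fun a => 2 ≤ u.count a).dedup with hA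
  have mem : ∀ a, a ∈ A ↔ 2 ≤ u.count a := by
    intro a
    simp only [hA, List.mem_dedup, List.mem_filter, decide_eq_true_eq, and_iff_right_iff_imp]
    exact fun h => List.count_pos_iff.1 (by omega)
  have hu : u.filter (· ∉ A) = simplePart u := by
    refine List.filter_congr fun a ha => ?_
    have := List.count_pos_iff.2 ha
    exact decide_eq_decide.2 (by rw [mem]; omega)
  have hv : v.filter (· ∉ A) = simplePart v := by
    refine List.filter_congr fun a ha => ?_
    have := List.count_pos_iff.2 ha
    have := h a
    exact decide_eq_decide.2 (by rw [mem]; omega)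
  rw [prod_eq_prod_sq_mul_prod_filter hM f A (List.nodup_dedup _) u fun a ha => (mem a).1 ha,
    prod_eq_prod_sq_mul_prod_filter hM f A (List.nodup_dedup _) v fun a ha => ?_, hu, hv, hs]
  have := h a
  have := (mem a).1 ha
  omega

end

theorem holdsIn_of_mem_varietyD {M : MonCat.{u}} (hM : M ∈ varietyD.{u}.carrier)
    {p : MonoidIdentity} (h : SameOccurrence p.1.toList p.2.toList)
    (hs : simplePart p.1.toList = simplePart p.2.toList) : p.HoldsIn M :=
  holdsIn_of_simplePart_eq (mem_varietyD_iff.1 hM) h hs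

/-- Without simple letters only the content matters in `D`; padding or taking powers brings an
identity to this form. -/
theorem holdsIn_of_no_simple_letter {M : MonCat.{u}} (hM : M ∈ varietyD.{u}.carrier)
    {p : MonoidIdentity} (h : ∀ a, p.1.toList.count a = 0 ↔ p.2.toList.count a = 0)
    (h1 : ∀ a, p.1.toList.count a ≠ 1) (h2 : ∀ a, p.2.toList.count a ≠ 1) : p.HoldsIn M := by
  refine holdsIn_of_mem_varietyD hM (fun a => ?_) ?_
  · have := h a
    have := h1 a
    have := h2 a
    omega
  · have : ∀ w : List ℕ, (∀ a, w.count a ≠ 1) → simplePart w = [] := fun w hw =>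
      List.eq_nil_iff_forall_not_mem.2 fun a ha => hw a (mem_simplePart.1 ha)
    rw [this _ h1, this _ h2]

/-! ### Small commutative members of `D` -/

theorem mem_varietyD_of_comm {M : Type u} [CommMonoid M] (h : ∀ x : M, x ^ 2 = x ^ 3) :
    MonCat.of M ∈ varietyD.{u}.carrier :=
  mem_varietyD_iff.2 fun (x y : M) =>
    ⟨h x, show x ^ 2 * y = x * y * x by rw [sq, mul_right_comm],
      show x * y * x = y * x ^ 2 by rw [sq, mul_comm x y, mul_assoc]⟩

/-- The two-element semilattice with identity. -/
abbrev Semilattice2 : Type u := ULift.{u} (ZMod 2)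

theorem Semilattice2.sq_eq (x : Semilattice2.{u}) : x ^ 2 = x := by
  have : ∀ y : ZMod 2, y ^ 2 = y := by decide
  exact ULift.ext _ _ (this x.down)

theorem same_content_of_holdsIn_semilattice2 {p : MonoidIdentity}
    (h : p.HoldsIn Semilattice2.{u}) (a : ℕ) :
    p.1.toList.count a = 0 ↔ p.2.toList.count a = 0 := by
  have e : (0 : ZMod 2) ^ p.1.toList.count a = 0 ^ p.2.toList.count a :=
    congrArg ULift.down (h.pow_count_eq a (ULift.up (0 : ZMod 2)))
  by_cases h1 : p.1.toList.count a = 0 <;> by_cases h2 : p.2.toList.count a = 0 <;>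
    simp_all [zero_pow]

/-- The three-element monoid `{1, a, 0}` with `a² = 0`, as the powers of `2` in `ZMod 4`. -/
abbrev Nilpotent3 : Type u := ULift.{u} (Submonoid.powers (2 : ZMod 4))

theorem two_pow_add_two (k : ℕ) : (2 : ZMod 4) ^ (k + 2) = 0 := by
  rw [pow_add, show (2 : ZMod 4) ^ 2 = 0 by decide, mul_zero]

theorem Nilpotent3.sq_eq (x : Nilpotent3.{u}) : x ^ 2 = x ^ 3 := by
  obtain ⟨⟨_, k, rfl⟩⟩ := x
  refine ULift.ext _ _ (Subtype.ext ?_)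
  change ((2 : ZMod 4) ^ k) ^ 2 = ((2 : ZMod 4) ^ k) ^ 3
  rcases k with _ | k
  · simp
  · rw [← pow_mul, ← pow_mul, show (k + 1) * 2 = 2 * k + 2 by ring,
      show (k + 1) * 3 = (3 * k + 1) + 2 by ring, two_pow_add_two, two_pow_add_two]

/-- The powers `1, 2, 0` of `2` in `ZMod 4` distinguish zero, one and at least two occurrences. -/
theorem sameOccurrence_of_holdsIn_nilpotent3 {p : MonoidIdentity}
    (h : p.HoldsIn Nilpotent3.{u}) : SameOccurrence p.1.toList p.2.toList := by
  intro a
  have e : (2 : ZMod 4) ^ p.1.toList.count a = 2 ^ p.2.toList.count a :=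
    congrArg (fun x : Nilpotent3.{u} => (x.down : ZMod 4))
      (h.pow_count_eq a (ULift.up ⟨2, Submonoid.mem_powers _⟩))
  have h1 : ¬ (1 : ZMod 4) = 2 := by decide
  have h2 : ¬ (1 : ZMod 4) = 0 := by decide
  have h3 : ¬ (2 : ZMod 4) = 0 := by decide
  generalize p.1.toList.count a = i at e
  generalize p.2.toList.count a = j at e
  rcases i with _ | _ | i <;> rcases j with _ | _ | j <;>
    simp_all [two_pow_add_two, eq_comm]

/-! ### `D` is a modular element -/

theorem count_toList_pow (w : FreeMonoid ℕ) (n a : ℕ) :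
    (w ^ n).toList.count a = n * w.toList.count a := by
  induction n with
  | zero => simp
  | succ n ih => rw [pow_succ, FreeMonoid.toList_mul, List.count_append, ih, Nat.succ_mul]

theorem sup_inf_le_of_exists_pow_eq_one {Y Z : MonoidVariety.{u}} {j : ℕ} (hj : j ≠ 0)
    (hZ : ∀ M ∈ Z.carrier, ∀ x : M, x ^ j = 1) : (varietyD ⊔ Y) ⊓ Z ≤ Y := by
  obtain ⟨T, hT⟩ := Y.isEquational
  rintro M ⟨hMD, hMZ⟩
  rw [hT]
  intro p hp f
  -- The prefix is trivial in `Z` thanks to the factor `j`; the factor `2` makes every letter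
  -- repeated, so the identity holds in `D`.
  have hq := hMD ((p.1 * p.2) ^ (2 * j) * p.1, (p.1 * p.2) ^ (2 * j) * p.2) ?_ f
  · simpa only [map_mul, map_pow, pow_mul', hZ M hMZ, one_pow, one_mul] using hq
  rintro N (hN | hN)
  · have big : ∀ a, ((p.1 * p.2).toList.count a = 0 ∧ ((p.1 * p.2) ^ (2 * j)).toList.count a = 0) ∨
        2 ≤ ((p.1 * p.2) ^ (2 * j)).toList.count a := by
      intro a
      rw [count_toList_pow, mul_assoc]
      rcases eq_or_ne ((p.1 * p.2).toList.count a) 0 with h | h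
      · exact Or.inl ⟨h, by rw [h, mul_zero, mul_zero]⟩
      right
      have := Nat.mul_pos (Nat.pos_of_ne_zero hj) (Nat.pos_of_ne_zero h)
      omega
    refine holdsIn_of_no_simple_letter hN (fun a => ?_) (fun a => ?_) (fun a => ?_)
    all_goals
      have := big a
      simp only [FreeMonoid.toList_mul, List.count_append] at this ⊢
      omega
  · intro g
    have := (hT ▸ hN : N ∈ monoidModels T) p hp g
    simp only [map_mul, map_pow, this]

/-- Raising both sides to the power `j` changes nothing in `Z` but removes simple letters; the
semilattice guarantees equal content. -/
theorem sup_inf_le_of_exists_pow_eq_self {Y Z : MonoidVariety.{u}} {j : ℕ} (hj : 2 ≤ j)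
    (hZ : ∀ M ∈ Z.carrier, ∀ x : M, x ^ j = x)
    (hS : MonCat.of Semilattice2.{u} ∈ (varietyD ⊓ Z).carrier) :
    (varietyD ⊔ Y) ⊓ Z ≤ (varietyD ⊓ Z) ⊔ Y := by
  rintro M ⟨hMD, hMZ⟩ p hp f
  have hcont := same_content_of_holdsIn_semilattice2 (hp _ (Or.inl hS))
  have hq := hMD (p.1 ^ j, p.2 ^ j) ?_ f
  · simpa only [map_pow, hZ M hMZ] using hq
  rintro N (hN | hN)
  · have count_ne_one : ∀ (w : FreeMonoid ℕ) (a : ℕ), j * w.toList.count a ≠ 1 := by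
      intro w a h
      have := Nat.eq_one_of_mul_eq_one_right h
      omega
    have hj0 : j ≠ 0 := by omega
    refine holdsIn_of_no_simple_letter hN (fun a => ?_) (fun a => ?_) (fun a => ?_)
    · simp only [count_toList_pow, mul_eq_zero, hj0, false_or, hcont a]
    · rw [count_toList_pow]
      exact count_ne_one _ _
    · rw [count_toList_pow]
      exact count_ne_one _ _
  · intro g
    simp only [map_pow, hp N (Or.inr hN) g]

theorem sup_inf_le_of_comm {Y Z : MonoidVariety.{u}} (hYZ : Y ≤ Z)
    (hZ : ∀ M ∈ Z.carrier, ∀ x y : M, x * y = y * x)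
    (hS : MonCat.of Nilpotent3.{u} ∈ (varietyD ⊓ Z).carrier) :
    (varietyD ⊔ Y) ⊓ Z ≤ (varietyD ⊓ Z) ⊔ Y := by
  rintro M ⟨hMD, hMZ⟩ p hp f
  have hocc := sameOccurrence_of_holdsIn_nilpotent3 (hp _ (Or.inl hS))
  set u := p.1.toList
  set v := p.2.toList
  -- A rearrangement of `v`, harmless in the commutative `Z` and `Y ≤ Z`, whose simple letters come
  -- in the order of `u`.
  set v' := simplePart u ++ v.filter (fun a => v.count a ≠ 1) with hv'
  have hsimple : (simplePart v).Perm (simplePart u) :=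
    (List.perm_ext_iff_of_nodup (nodup_simplePart v) (nodup_simplePart u)).2 fun a => by
      rw [mem_simplePart, mem_simplePart, hocc.count_eq_one_iff]
  have hperm : v.Perm v' := by
    refine (List.filter_append_perm (fun a => v.count a = 1) v).symm.trans ?_
    have : (v.filter fun a => !decide (v.count a = 1)) = v.filter (fun a => v.count a ≠ 1) :=
      List.filter_congr fun a _ => by simp
    rw [this]
    exact hsimple.append_right _
  have hlift : ∀ (N : MonCat.{u}), N ∈ Z.carrier → ∀ g : ℕ → N,
      FreeMonoid.lift g p.2 = FreeMonoid.lift g (FreeMonoid.ofList v') := by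
    intro N hN g
    rw [FreeMonoid.lift_apply, FreeMonoid.lift_apply, FreeMonoid.toList_ofList]
    refine (hperm.map g).prod_eq' ?_
    exact List.pairwise_iff_forall_sublist.2 fun {x y} _ => hZ N hN x y
  have hq := hMD (p.1, FreeMonoid.ofList v') ?_ f
  · exact hq.trans (hlift M hMZ f).symm
  rintro N (hN | hN)
  · refine holdsIn_of_mem_varietyD hN (fun a => ?_) ?_
    · rw [FreeMonoid.toList_ofList, ← hperm.count_eq]
      exact hocc a
    · rw [FreeMonoid.toList_ofList]
      change simplePart u = simplePart v'
      have h1 : simplePart v' = v'.filter fun a => v.count a = 1 :=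
        List.filter_congr fun a _ => by rw [hperm.count_eq]
      have h2 : ((simplePart u).filter fun a => v.count a = 1) = simplePart u :=
        List.filter_eq_self.2 fun a ha =>
          decide_eq_true ((hocc.count_eq_one_iff a).1 (mem_simplePart.1 ha))
      have h3 : ((v.filter fun a => v.count a ≠ 1).filter fun a => v.count a = 1) = [] := by
        rw [List.filter_eq_nil_iff]
        intro a ha
        simpa using (List.mem_filter.1 ha).2
      rw [h1, hv', List.filter_append, h2, h3, List.append_nil]
  · intro g
    exact (hp N (Or.inr hN) g).trans (hlift N (hYZ hN) g)

theorem sup_inf_le {Y Z : MonoidVariety.{u}} (hYZ : Y ≤ Z) :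
    (varietyD ⊔ Y) ⊓ Z ≤ (varietyD ⊓ Z) ⊔ Y := by
  obtain ⟨S, hS⟩ := Z.isEquational
  have holds : ∀ p ∈ S, ∀ M ∈ Z.carrier, p.HoldsIn M := fun p hp M hM =>
    (hS ▸ hM : M ∈ monoidModels S) p hp
  by_cases hcont : ∀ p ∈ S, ∀ a, p.1.toList.count a = 0 ↔ p.2.toList.count a = 0
  swap
  · push Not at hcont
    obtain ⟨p, hp, a, h⟩ := hcont
    have hpow : ∀ M ∈ Z.carrier, ∀ x : M, x ^ p.1.toList.count a = x ^ p.2.toList.count a :=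
      fun M hM x => (holds p hp M hM).pow_count_eq a x
    refine le_trans ?_ le_sup_right
    rcases h with ⟨h1, h2⟩ | ⟨h1, h2⟩
    · exact sup_inf_le_of_exists_pow_eq_one h2 fun M hM x => by rw [← hpow M hM, h1, pow_zero]
    · exact sup_inf_le_of_exists_pow_eq_one h1 fun M hM x => by rw [hpow M hM, h2, pow_zero]
  by_cases hocc : ∀ p ∈ S, SameOccurrence p.1.toList p.2.toList
  swap
  · simp only [SameOccurrence] at hocc
    push Not at hocc
    obtain ⟨p, hp, a, h⟩ := hocc
    have hpow : ∀ M ∈ Z.carrier, ∀ x : M, x ^ p.1.toList.count a = x ^ p.2.toList.count a :=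
      fun M hM x => (holds p hp M hM).pow_count_eq a x
    have hmem : MonCat.of Semilattice2.{u} ∈ (varietyD ⊓ Z).carrier := by
      refine ⟨mem_varietyD_of_comm fun x => ?_, ?_⟩
      · rw [pow_succ x 2, Semilattice2.sq_eq, ← sq, Semilattice2.sq_eq]
      · rw [hS]
        exact fun q hq => MonoidIdentity.holdsIn_of_same_content (M := Semilattice2.{u})
          (hcont q hq) Semilattice2.sq_eq
    -- Since contents agree, a failure of `h` means that one count is `1` and the other at least
    -- `2`.
    have hc := hcont p hp a
    by_cases h1 : p.1.toList.count a = 1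
    · exact sup_inf_le_of_exists_pow_eq_self (j := p.2.toList.count a) (by omega)
        (fun M hM x => by rw [← hpow M hM, h1, pow_one]) hmem
    · have h2 : p.2.toList.count a = 1 := by omega
      exact sup_inf_le_of_exists_pow_eq_self (j := p.1.toList.count a) (by omega)
        (fun M hM x => by rw [hpow M hM, h2, pow_one]) hmem
  by_cases hord : ∀ p ∈ S, simplePart p.1.toList = simplePart p.2.toList
  · have hDZ : varietyD ≤ Z := by
      intro M hM
      rw [hS]
      exact fun p hp => holdsIn_of_mem_varietyD hM (hocc p hp) (hord p hp)
    rw [inf_eq_left.2 hDZ]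
    exact inf_le_left
  · push Not at hord
    obtain ⟨p, hp, h⟩ := hord
    refine sup_inf_le_of_comm hYZ
      (fun M hM x y => (holds p hp M hM).exists_mul_eq (hocc p hp) h x y)
      ⟨mem_varietyD_of_comm Nilpotent3.sq_eq, ?_⟩
    rw [hS]
    exact fun q hq => MonoidIdentity.holdsIn_of_sameOccurrence (M := Nilpotent3.{u})
      (hocc q hq) Nilpotent3.sq_eq

theorem isModularElement_varietyD : IsModularElement varietyD.{u} := fun _ _ hYZ =>
  le_antisymm (sup_inf_le hYZ)
    (sup_le (le_inf (inf_le_left.trans le_sup_left) inf_le_right) (le_inf le_sup_right hYZ))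

/-! ### `D` is not a costandard element -/

/-- The variety of left regular band monoids, `var {x² ≈ x, xyx ≈ xy}`. -/
def leftRegularBands : MonoidVariety.{u} :=
  var {(letterX ^ 2, letterX), (letterX * letterY * letterX, letterX * letterY)}

/-- The variety `var {x² ≈ x³, xy ≈ yx}`. -/
def commAperiodic : MonoidVariety.{u} :=
  var {(letterX ^ 2, letterX ^ 3), (letterX * letterY, letterY * letterX)}

/-- The two-element left zero band `{e, f}` with an identity element adjoined. -/
inductive LeftZeroBand : Type u
  | one | e | f

namespace LeftZeroBand

/-- The product, in which the left factor absorbs the right one unless it is the identity. -/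
def mul : LeftZeroBand.{u} → LeftZeroBand.{u} → LeftZeroBand.{u}
  | one, y => y
  | e, _ => e
  | f, _ => f

instance : Monoid LeftZeroBand.{u} where
  mul := mul
  one := one
  mul_assoc x y z := by cases x <;> rfl
  one_mul _ := rfl
  mul_one x := by cases x <;> rfl

theorem mem_leftRegularBands : MonCat.of LeftZeroBand.{u} ∈ leftRegularBands.{u}.carrier := by
  rintro p (rfl | rfl) g
  · simp only [letterX, map_pow, FreeMonoid.lift_eval_of]
    rw [sq]
    generalize g 0 = x
    cases x <;> rfl
  · simp only [letterX, letterY, map_mul, FreeMonoid.lift_eval_of]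
    generalize g 0 = x
    generalize g 1 = y
    cases x <;> cases y <;> rfl

end LeftZeroBand

/-- The monoid `{1, a, b, ab, 0}` with `a² = b² = ba = 0`. -/
inductive Nilpotent5 : Type u
  | one | a | b | ab | zero

namespace Nilpotent5

/-- The product of `Nilpotent5`. -/
def mul : Nilpotent5.{u} → Nilpotent5.{u} → Nilpotent5.{u}
  | one, y => y
  | x, one => x
  | a, b => ab
  | _, _ => zero

instance : Monoid Nilpotent5.{u} where
  mul := mul
  one := one
  mul_assoc x y z := by cases x <;> cases y <;> cases z <;> rfl
  one_mul _ := rfl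
  mul_one x := by cases x <;> rfl

theorem mem_varietyD : MonCat.of Nilpotent5.{u} ∈ varietyD.{u}.carrier := by
  refine mem_varietyD_iff.2 fun (x y : Nilpotent5.{u}) => ?_
  refine ⟨?_, ?_, ?_⟩
  · show x ^ 2 = x ^ 3
    rw [pow_succ x 2, sq]
    cases x <;> rfl
  · show x ^ 2 * y = x * y * x
    rw [sq]
    cases x <;> cases y <;> rfl
  · show x * y * x = y * x ^ 2
    rw [sq]
    cases x <;> cases y <;> rfl

end Nilpotent5

theorem mem_commAperiodic_iff {M : MonCat.{u}} :
    M ∈ commAperiodic.{u}.carrier ↔ ∀ x y : M, x ^ 2 = x ^ 3 ∧ x * y = y * x := by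
  constructor
  · intro h x y
    have h1 := h _ (Or.inl rfl) (fun n => if n = 0 then x else y)
    have h2 := h _ (Or.inr rfl) (fun n => if n = 0 then x else y)
    simp only [map_mul, map_pow, letterX, letterY, FreeMonoid.lift_eval_of, if_true,
      one_ne_zero, if_false] at h1 h2
    exact ⟨h1, h2⟩
  · rintro h p (rfl | rfl) f
    · simpa [letterX, letterY] using (h (f 0) (f 1)).1
    · simpa [letterX, letterY] using (h (f 0) (f 1)).2

/-- Idempotency turns the centrality of squares into commutativity. -/
theorem varietyD_inf_leftRegularBands_le :
    varietyD.{u} ⊓ leftRegularBands ≤ commAperiodic := by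
  rintro M ⟨hD, hL⟩
  refine mem_commAperiodic_iff.2 fun x y => ?_
  obtain ⟨h1, h2, h3⟩ := mem_varietyD_iff.1 hD x y
  have h4 := hL _ (Or.inl rfl) (fun n => if n = 0 then x else y)
  simp only [map_pow, letterX, FreeMonoid.lift_eval_of, if_true] at h4
  refine ⟨h1, ?_⟩
  rw [h4] at h2 h3
  exact h2.trans h3

/-- `Nilpotent3` in `commAperiodic` controls occurrences; the noncommutative `LeftZeroBand` fixes
the order of simple letters. -/
theorem varietyD_le_leftRegularBands_sup :
    varietyD.{u} ≤ leftRegularBands ⊔ commAperiodic := by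
  intro M hM p hp
  have hocc : SameOccurrence p.1.toList p.2.toList :=
    sameOccurrence_of_holdsIn_nilpotent3.{u} <| hp (MonCat.of Nilpotent3.{u}) <| Or.inr <|
      mem_commAperiodic_iff.2 fun (x y : Nilpotent3.{u}) => ⟨Nilpotent3.sq_eq x, mul_comm x y⟩
  refine holdsIn_of_mem_varietyD hM hocc ?_
  by_contra hne
  have hL : p.HoldsIn LeftZeroBand.{u} := hp _ (Or.inl LeftZeroBand.mem_leftRegularBands)
  have h : LeftZeroBand.e.{u} = LeftZeroBand.f :=
    hL.exists_mul_eq hocc hne LeftZeroBand.e LeftZeroBand.f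
  cases h

theorem not_isCostandardElement_varietyD : ¬ IsCostandardElement varietyD.{u} := by
  intro h
  have hle : varietyD.{u} ≤ commAperiodic := by
    calc varietyD.{u} ≤ (varietyD ⊔ commAperiodic) ⊓ (leftRegularBands ⊔ commAperiodic) :=
          le_inf le_sup_left varietyD_le_leftRegularBands_sup
      _ = (varietyD ⊓ leftRegularBands) ⊔ commAperiodic := (h _ _).symm
      _ ≤ commAperiodic := sup_le varietyD_inf_leftRegularBands_le le_rfl
  have e : Nilpotent5.ab.{u} = Nilpotent5.zero :=
    (mem_commAperiodic_iff.1 (hle Nilpotent5.mem_varietyD) Nilpotent5.a Nilpotent5.b).2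
  cases e

end MonoidVariety

theorem fact1 :
    IsModularElement MonoidVariety.varietyD.{u} ∧
    ¬ IsCostandardElement MonoidVariety.varietyD.{u} ∧
    ¬ (∀ V : MonoidVariety.{u}, IsModularElement V ↔ IsCostandardElement V) :=
  ⟨MonoidVariety.isModularElement_varietyD, MonoidVariety.not_isCostandardElement_varietyD,
    fun h => MonoidVariety.not_isCostandardElement_varietyD
      ((h _).1 MonoidVariety.isModularElement_varietyD)⟩
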